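/- For a finite simple graph $G$ and $X\subseteq V(G)$ let $\Gamma_G(X)=\{u\in V(G)\setminus X: uv\in E(G)\text{ for some }v\in X\}$. For $\varepsilon_1,t>0$ put $\varepsilon(x)=0$ if $x<t/5$ and $\varepsilon(x)=\varepsilon_1/\log^2(15x/t)$ if $x\ge t/5$, where $\log$ is the natural logarithm. The graph $G$ is an $(\varepsilon_1,t)$-expander if $|\Gamma_G(X)|\ge\varepsilon(|X|)\,|X|$ for every $X\subseteq V(G)$ with $t/2\le|X|\le|V(G)|/2$. Theorem 1.4. Let $0<\varepsilon_1\le1$ and $L\ge1$ be real numbers. Then there exist real numbers $d_0$ and $K_0$, depending only on $\varepsilon_1$ and $L$, such that the following holds for all real $d\ge d_0$ and $K\ge K_0$ and every $n\in\mathbb N$ with $(\log n)^{100}\le d\le n/K$. Let $H$ be an $n$-vertex $(\varepsilon_1,d/30)$-expander whose minimum degree $\delta(H)$ and maximum degree $\Delta(H)$ satisfy $d/10\le\delta(H)\le\Delta(H)\le Ld$. Then there is a set $Z\subseteq V(H)$ with $|Z|=\lfloor200d\rfloor$ such that, for every subset $U\subseteq Z$ with $|U|=\lfloor100d\rfloor$,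 there is a cycle $C_U$ in $H$ with $V(C_U)\cap Z\subseteq U$ and $|V(C_U)\cap Z|\ge98d$. (If $d$ is an integer, then $|Z|=200d$ and $|U|=100d$.) -/

import Mathlib

/-- The external neighbourhood `Γ_G(X) = N_G(X) \ X` of a set `X` of vertices. -/
def SimpleGraph.extNeighborFinset {V : Type*} [Fintype V] [DecidableEq V]
    (G : SimpleGraph V) [DecidableRel G.Adj] (X : Finset V) : Finset V :=
  Finset.univ.filter (fun u => u ∉ X ∧ ∃ v ∈ X, G.Adj u v)

/-- The expansion rate `ε(x) = ε(x, ε₁, t)`: it is `0` for `x < t / 5` and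
`ε₁ / log² (15 x / t)` for `x ≥ t / 5`. -/
noncomputable def expansionRate (ε₁ t x : ℝ) : ℝ :=
  if x < t / 5 then 0 else ε₁ / (Real.log (15 * x / t)) ^ 2

/-- `G` is an `(ε₁, t)`-expander: every set `X` of vertices with `t / 2 ≤ |X| ≤ |G| / 2`
satisfies `|Γ_G(X)| ≥ ε(|X|) |X|`. -/
def SimpleGraph.IsExpander {V : Type*} [Fintype V] [DecidableEq V]
    (G : SimpleGraph V) [DecidableRel G.Adj] (ε₁ t : ℝ) : Prop :=
  ∀ X : Finset V, t / 2 ≤ (X.card : ℝ) → (X.card : ℝ) ≤ (Fintype.card V : ℝ) / 2 →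
    expansionRate ε₁ t (X.card : ℝ) * (X.card : ℝ) ≤ ((G.extNeighborFinset X).card : ℝ)

/-! Let `s = ⌈d / 40⌉` and let `Q` be the ceiling of `log (450 n / d)`. Every set of size between
`s` and `n / 2` expands by a factor `1 / Q ^ 3`, so balls around two sets of size at least `2 * s`
both fill more than half of the graph within `4 * Q ^ 4` steps, even when a set `W` smaller than
either by a factor `4 * Q ^ 3` is deleted. Hence such sets are joined by short walks avoiding `W`
(`connectsAvoiding_of_expansion`).

A cycle through about `100 d` prescribed vertices uses more vertices than a single neighbourhood of
order `d` can withstand as `W`. Each vertex of `Z` is therefore made the centre of a web: `Q ^ 12`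
short branches ending in hubs with `s` leaves each. The leaves number `Q ^ 12 * s`, far more than
the cycle, while the interior has only about `Q ^ 16` vertices, so all interiors can be chosen
disjoint (`exists_web_avoiding`, `exists_disjoint_webs`).

Given `U`, a path is grown from centre to centre inside `U`, linking leaves of the current web to
leaves of a fresh one (`exists_path_through_webs`). Disjointness of interiors means that the path
can spoil half of the branches in only a small number `b` of webs, so a usable centre remains until
nearly all of `U` is visited. To close up, the path is cut at its first centre whose web is still
usable, and that web is joined to the last one (`exists_cycle_through_webs`). At most `b` visited
centres are lost by the cut. -/

/-- `x` and `y` are joined by a walk of `G` all of whose vertices lie in `F`. -/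
def SimpleGraph.JoinedIn {V : Type*} (G : SimpleGraph V) (F : Finset V) (x y : V) : Prop :=
  ∃ p : G.Walk x y, ∀ v ∈ p.support, v ∈ F

namespace SimpleGraph

/-! ### Walks inside a vertex set. -/

section JoinedIn

variable {V : Type*} {G : SimpleGraph V} {F F' : Finset V} {x y z : V}

lemma JoinedIn.left_mem (h : G.JoinedIn F x y) : x ∈ F := by
  obtain ⟨p, hp⟩ := h
  exact hp _ p.start_mem_support

lemma JoinedIn.right_mem (h : G.JoinedIn F x y) : y ∈ F := by
  obtain ⟨p, hp⟩ := h
  exact hp _ p.end_mem_support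

lemma JoinedIn.mono (h : G.JoinedIn F x y) (hF : F ⊆ F') : G.JoinedIn F' x y := by
  obtain ⟨p, hp⟩ := h
  exact ⟨p, fun v hv => hF (hp v hv)⟩

lemma JoinedIn.symm (h : G.JoinedIn F x y) : G.JoinedIn F y x := by
  obtain ⟨p, hp⟩ := h
  exact ⟨p.reverse, fun v hv => hp v (by simpa using hv)⟩

lemma JoinedIn.trans (h : G.JoinedIn F x y) (h' : G.JoinedIn F y z) : G.JoinedIn F x z := by
  obtain ⟨p, hp⟩ := h
  obtain ⟨q, hq⟩ := h'
  refine ⟨p.append q, fun v hv => ?_⟩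
  rcases Walk.mem_support_append_iff _ _ |>.1 hv with hv | hv
  exacts [hp v hv, hq v hv]

lemma JoinedIn.of_adj (h : G.Adj x y) (hx : x ∈ F) (hy : y ∈ F) : G.JoinedIn F x y :=
  ⟨h.toWalk, fun v hv => by
    simp only [Walk.support_cons, Walk.support_nil, List.mem_cons, List.not_mem_nil,
      or_false] at hv
    rcases hv with rfl | rfl <;> assumption⟩

lemma JoinedIn.refl (hx : x ∈ F) : G.JoinedIn F x x :=
  ⟨Walk.nil, fun v hv => by simp at hv; rwa [hv]⟩

lemma JoinedIn.exists_isPath [DecidableEq V] (h : G.JoinedIn F x y) :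
    ∃ p : G.Walk x y, p.IsPath ∧ ∀ v ∈ p.support, v ∈ F := by
  obtain ⟨p, hp⟩ := h
  exact ⟨p.bypass, p.bypass_isPath, fun v hv => hp v (p.support_bypass_subset_support hv)⟩

end JoinedIn

/-! ### Ball growth and short connections avoiding a small set. -/

section Growth

variable {V : Type*} [Fintype V] [DecidableEq V] (G : SimpleGraph V) [DecidableRel G.Adj]

/-- The vertices reachable from `A` in at most `i` steps avoiding `W`. -/
def ballAvoiding (A W : Finset V) : ℕ → Finset V
  | 0 => A
  | i + 1 => ballAvoiding A W i ∪ (G.extNeighborFinset (ballAvoiding A W i) \ W)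

variable {G}

lemma exists_joinedIn_of_mem_ballAvoiding {A W : Finset V} (hAW : Disjoint A W) (i : ℕ) {v : V}
    (hv : v ∈ G.ballAvoiding A W i) :
    ∃ a ∈ A, ∃ F : Finset V, G.JoinedIn F a v ∧ F.card ≤ i + 1 ∧ Disjoint F W := by
  induction i generalizing v with
  | zero =>
    exact ⟨v, hv, {v}, JoinedIn.refl (by simp), by simp,
      by simpa using Finset.disjoint_left.1 hAW hv⟩
  | succ i ih =>
    rcases Finset.mem_union.1 hv with hv | hv
    · obtain ⟨a, ha, F, h1, h2, h3⟩ := ih hv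
      exact ⟨a, ha, F, h1, by omega, h3⟩
    · obtain ⟨hv, hvW⟩ := Finset.mem_sdiff.1 hv
      simp only [extNeighborFinset, Finset.mem_filter] at hv
      obtain ⟨-, -, u, hu, huv⟩ := hv
      obtain ⟨a, ha, F, h1, h2, h3⟩ := ih hu
      refine ⟨a, ha, insert v F, (h1.mono (Finset.subset_insert _ _)).trans
        (JoinedIn.of_adj huv.symm (Finset.mem_insert_of_mem h1.right_mem)
          (Finset.mem_insert_self _ _)), ?_, ?_⟩
      · exact (Finset.card_insert_le _ _).trans (by omega)
      · exact Finset.disjoint_insert_left.2 ⟨hvW, h3⟩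

lemma card_ballAvoiding_succ (A W : Finset V) (i : ℕ) :
    (G.ballAvoiding A W i).card + (G.extNeighborFinset (G.ballAvoiding A W i)).card ≤
      (G.ballAvoiding A W (i + 1)).card + W.card := by
  have hd : Disjoint (G.ballAvoiding A W i)
      (G.extNeighborFinset (G.ballAvoiding A W i) \ W) := by
    rw [Finset.disjoint_left]
    intro v hv hv'
    simp only [extNeighborFinset, Finset.mem_sdiff, Finset.mem_filter] at hv'
    exact hv'.1.2.1 hv
  have := Finset.card_union_of_disjoint hd
  have h2 := Finset.le_card_sdiff W (G.extNeighborFinset (G.ballAvoiding A W i))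
  rw [ballAvoiding, this]
  omega

/-- A ball of size `b` up to half the graph has at least `b / r` outer neighbours. Deleting `W`
costs at most `|A| / (2r) ≤ b / (2r)` of them, so half of the expansion survives at each step. -/
lemma card_ballAvoiding_growth {s r : ℕ} (hr : 0 < r)
    (hG : ∀ X : Finset V, s ≤ X.card → 2 * X.card ≤ Fintype.card V →
      X.card ≤ r * (G.extNeighborFinset X).card)
    {A W : Finset V} (hA : s ≤ A.card) (hW : 2 * r * W.card ≤ A.card) (i : ℕ) :
    Fintype.card V < 2 * (G.ballAvoiding A W i).card ∨
      (A.card : ℝ) * (1 + 1 / (2 * r)) ^ i ≤ (G.ballAvoiding A W i).card := by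
  have hr' : (0 : ℝ) < r := by exact_mod_cast hr
  induction i with
  | zero => right; simp [ballAvoiding]
  | succ i ih =>
    rcases ih with ih | ih
    · left
      refine ih.trans_le (Nat.mul_le_mul_left _ (Finset.card_le_card ?_))
      exact Finset.subset_union_left
    · by_cases hbig : Fintype.card V < 2 * (G.ballAvoiding A W i).card
      · left
        refine hbig.trans_le (Nat.mul_le_mul_left _ (Finset.card_le_card ?_))
        exact Finset.subset_union_left
      right
      have hAB : (A.card : ℝ) ≤ (G.ballAvoiding A W i).card := by
        refine le_trans ?_ ih
        exact le_mul_of_one_le_right (by positivity) (one_le_pow₀ (by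
          have : (0 : ℝ) ≤ 1 / (2 * r) := by positivity
          linarith))
      have hAB' : A.card ≤ (G.ballAvoiding A W i).card := by exact_mod_cast hAB
      have h1 := hG _ (hA.trans hAB') (not_lt.1 hbig)
      have h2 := card_ballAvoiding_succ (G := G) A W i
      set b := (G.ballAvoiding A W i).card
      set g := (G.extNeighborFinset (G.ballAvoiding A W i)).card
      have h1' : (b : ℝ) / r ≤ g := by
        rw [div_le_iff₀ hr']
        have : (b : ℝ) ≤ r * g := by exact_mod_cast h1
        linarith
      have h2' : (b : ℝ) + g ≤ (G.ballAvoiding A W (i + 1)).card + W.card := by exact_mod_cast h2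
      have h3 : (W.card : ℝ) ≤ b / (2 * r) := by
        rw [le_div_iff₀ (by positivity)]
        have : (2 * r * W.card : ℝ) ≤ A.card := by exact_mod_cast hW
        linarith
      have h4 : (b : ℝ) / r = b / (2 * r) + b / (2 * r) := by field_simp; ring
      calc (A.card : ℝ) * (1 + 1 / (2 * r)) ^ (i + 1)
          = (A.card : ℝ) * (1 + 1 / (2 * r)) ^ i * (1 + 1 / (2 * r)) := by ring
        _ ≤ b * (1 + 1 / (2 * r)) := by gcongr
        _ = b + b / (2 * r) := by ring
        _ ≤ _ := by linarith

/-- Any two vertex sets of size at least `s` that are `r` times larger than `W` contain vertices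
joined by a walk on at most `m` vertices avoiding `W`. -/
def ConnectsAvoiding (G : SimpleGraph V) (s r m : ℕ) : Prop :=
  ∀ A B W : Finset V, s ≤ A.card → s ≤ B.card → r * W.card ≤ A.card → r * W.card ≤ B.card →
    ∃ a ∈ A, ∃ b ∈ B, ∃ F : Finset V, G.JoinedIn F a b ∧ F.card ≤ m ∧ Disjoint F W

/-- Both balls outgrow half of the vertex set, so they intersect. Starting from `2 * s` leaves at
least `s` vertices after `W` is removed, and two walks on `ℓ + 1` vertices each give `2 * ℓ + 2`. -/
lemma connectsAvoiding_of_expansion {s r ℓ : ℕ} (hr : 0 < r)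
    (hG : ∀ X : Finset V, s ≤ X.card → 2 * X.card ≤ Fintype.card V →
      X.card ≤ r * (G.extNeighborFinset X).card)
    (hℓ : (Fintype.card V : ℝ) < 2 * (s * (1 + 1 / (2 * r)) ^ ℓ)) :
    G.ConnectsAvoiding (2 * s) (4 * r) (2 * ℓ + 2) := by
  have key : ∀ A W : Finset V, 2 * s ≤ A.card → 4 * r * W.card ≤ A.card →
      Fintype.card V < 2 * (G.ballAvoiding (A \ W) W ℓ).card := by
    intro A W hA hW
    have hc := Finset.le_card_sdiff W A
    have hW2 : 2 * W.card ≤ 4 * r * W.card := Nat.mul_le_mul_right _ (by omega)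
    have hW3 : 2 * (2 * r * W.card) = 4 * r * W.card := by ring
    have hs : s ≤ (A \ W).card := by omega
    rcases card_ballAvoiding_growth hr hG hs (W := W) (by omega) ℓ with h | h
    · exact h
    · have : (s : ℝ) * (1 + 1 / (2 * r)) ^ ℓ ≤ (A \ W).card * (1 + 1 / (2 * r)) ^ ℓ := by
        gcongr
      have : (Fintype.card V : ℝ) < 2 * (G.ballAvoiding (A \ W) W ℓ).card := by linarith
      exact_mod_cast this
  intro A B W hA hB hAW hBW
  have h1 := key A W hA hAW
  have h2 := key B W hB hBW
  obtain ⟨v, hv⟩ : (G.ballAvoiding (A \ W) W ℓ ∩ G.ballAvoiding (B \ W) W ℓ).Nonempty := by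
    rw [← Finset.card_pos]
    have h3 := Finset.card_union_add_card_inter (G.ballAvoiding (A \ W) W ℓ)
      (G.ballAvoiding (B \ W) W ℓ)
    have h4 := Finset.card_le_univ (G.ballAvoiding (A \ W) W ℓ ∪ G.ballAvoiding (B \ W) W ℓ)
    omega
  obtain ⟨hvA, hvB⟩ := Finset.mem_inter.1 hv
  obtain ⟨a, ha, F, h5, h6, h7⟩ := exists_joinedIn_of_mem_ballAvoiding Finset.sdiff_disjoint ℓ hvA
  obtain ⟨b, hb, F', h8, h9, h10⟩ := exists_joinedIn_of_mem_ballAvoiding Finset.sdiff_disjoint ℓ hvB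
  refine ⟨a, (Finset.mem_sdiff.1 ha).1, b, (Finset.mem_sdiff.1 hb).1, F ∪ F',
    (h5.mono Finset.subset_union_left).trans (h8.mono Finset.subset_union_right).symm, ?_, ?_⟩
  · exact (Finset.card_union_le _ _).trans (by omega)
  · exact Finset.disjoint_union_left.2 ⟨h7, h10⟩

end Growth

/-! ### Disjoint stars. -/

section Stars

variable {V : Type*} [Fintype V] [DecidableEq V] {G : SimpleGraph V} [DecidableRel G.Adj]

/-- If few vertices are forbidden, some allowed vertex has many allowed neighbours. -/
lemma exists_star_avoiding {s D : ℕ} (hs : 0 < s) (hmin : ∀ v, 2 * s ≤ G.degree v)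
    (hmax : ∀ v, G.degree v ≤ D * s) {X : Finset V} (hX : (D + 1) * X.card < Fintype.card V) :
    ∃ v ∉ X, ∃ S ⊆ G.neighborFinset v, S.card = s ∧ Disjoint S X := by
  by_contra! hcon
  -- Double counting: without such a star, each outside vertex sends at least `s` of its `2 * s`
  -- edges into `X`, whereas each vertex of `X` receives at most `D * s`.
  have hbad : ∀ v ∈ Xᶜ, s ≤ (G.neighborFinset v ∩ X).card := by
    intro v hv
    by_contra! hlt
    have h1 := Finset.card_sdiff_add_card_inter (G.neighborFinset v) X
    have h2 := hmin v
    rw [← G.card_neighborFinset_eq_degree] at h2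
    obtain ⟨S, hS, hSc⟩ := Finset.exists_subset_card_eq
      (s := G.neighborFinset v \ X) (n := s) (by omega)
    exact hcon v (by simpa using hv) S (hS.trans Finset.sdiff_subset) hSc
      (Finset.sdiff_disjoint.mono_left hS)
  have h1 : Xᶜ.card * s ≤ X.card * (D * s) := by
    refine Finset.card_mul_le_card_mul (fun v x => G.Adj v x) ?_ ?_
    · intro v hv
      refine (hbad v hv).trans (Finset.card_le_card ?_)
      intro x hx
      simp only [Finset.mem_inter, mem_neighborFinset] at hx
      simp [Finset.mem_bipartiteAbove, hx.1, hx.2]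
    · intro x _
      refine le_trans (Finset.card_le_card ?_)
        ((G.card_neighborFinset_eq_degree x).trans_le (hmax x))
      intro v hv
      simp only [Finset.mem_bipartiteBelow] at hv
      simpa using hv.2.symm
  have h2 : Xᶜ.card ≤ X.card * D := by
    rw [← mul_assoc] at h1
    exact Nat.le_of_mul_le_mul_right h1 hs
  have h3 := Finset.card_add_card_compl X
  nlinarith

/-- A family of vertex-disjoint stars with `s` leaves each, avoiding `X`. -/
structure StarFamily (G : SimpleGraph V) [DecidableRel G.Adj] (ι : Type*) (s : ℕ)
    (X : Finset V) where
  center : ι → V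
  leaves : ι → Finset V
  leaves_subset : ∀ i, leaves i ⊆ G.neighborFinset (center i)
  card_leaves : ∀ i, (leaves i).card = s
  disjoint_avoid : ∀ i, Disjoint (insert (center i) (leaves i)) X
  pairwise_disjoint : ∀ i j, i ≠ j →
    Disjoint (insert (center i) (leaves i)) (insert (center j) (leaves j))

lemma exists_starFamily_fin {s D : ℕ} (hs : 0 < s) (hmin : ∀ v, 2 * s ≤ G.degree v)
    (hmax : ∀ v, G.degree v ≤ D * s) (X : Finset V) (N : ℕ)
    (hX : (D + 1) * (X.card + N * (s + 1)) < Fintype.card V) :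
    Nonempty (G.StarFamily (Fin N) s X) := by
  induction N with
  | zero =>
    exact ⟨⟨fun i => i.elim0, fun i => i.elim0, fun i => i.elim0, fun i => i.elim0,
      fun i => i.elim0, fun i => i.elim0⟩⟩
  | succ N ih =>
    obtain ⟨S⟩ := ih (lt_of_le_of_lt (Nat.mul_le_mul_left _ (Nat.add_le_add_left
      (Nat.mul_le_mul_right _ (Nat.le_succ N)) _)) hX)
    set Y := Finset.univ.biUnion fun i => insert (S.center i) (S.leaves i) with hY
    have hYc : Y.card ≤ N * (s + 1) := by
      refine (Finset.card_biUnion_le_card_mul _ _ (s + 1) fun i _ => ?_).trans (by simp)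
      exact (Finset.card_insert_le _ _).trans (by rw [S.card_leaves])
    have hXY : (X ∪ Y).card ≤ X.card + (N + 1) * (s + 1) := by
      refine (Finset.card_union_le _ _).trans (Nat.add_le_add_left (hYc.trans ?_) _)
      exact Nat.mul_le_mul_right _ (Nat.le_succ N)
    obtain ⟨v, hv, T, hT, hTc, hTX⟩ := exists_star_avoiding hs hmin hmax (X := X ∪ Y)
      (lt_of_le_of_lt (Nat.mul_le_mul_left _ hXY) hX)
    have hnew : Disjoint (insert v T) (X ∪ Y) := Finset.disjoint_insert_left.2 ⟨hv, hTX⟩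
    have hnewY : ∀ i, Disjoint (insert v T) (insert (S.center i) (S.leaves i)) := fun i =>
      hnew.mono_right ((Finset.subset_biUnion_of_mem
        (fun i => insert (S.center i) (S.leaves i)) (Finset.mem_univ i)).trans
        Finset.subset_union_right)
    refine ⟨⟨Fin.cons v S.center, Fin.cons T S.leaves, ?_, ?_, ?_, ?_⟩⟩
    · exact Fin.cases hT S.leaves_subset
    · exact Fin.cases hTc S.card_leaves
    · exact Fin.cases (hnew.mono_right Finset.subset_union_left) S.disjoint_avoid
    · refine Fin.cases (Fin.cases (fun h => (h rfl).elim) fun j _ => hnewY j)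
        fun i => Fin.cases (fun _ => (hnewY i).symm) fun j hij => ?_
      exact S.pairwise_disjoint i j (fun h => hij (by rw [h]))

/-- The subfamily of a star family along an injection. -/
def StarFamily.comp {ι κ : Type*} {s : ℕ} {X : Finset V} (S : G.StarFamily ι s X)
    (f : κ ↪ ι) : G.StarFamily κ s X where
  center := S.center ∘ f
  leaves := S.leaves ∘ f
  leaves_subset k := S.leaves_subset (f k)
  card_leaves k := S.card_leaves (f k)
  disjoint_avoid k := S.disjoint_avoid (f k)
  pairwise_disjoint _ _ hij := S.pairwise_disjoint _ _ (f.injective.ne hij)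

section Lemmas

variable {ι : Type*} {s : ℕ} {X : Finset V} (S : G.StarFamily ι s X)

lemma StarFamily.disjoint_leaves {i j : ι} (hij : i ≠ j) : Disjoint (S.leaves i) (S.leaves j) :=
  (S.pairwise_disjoint i j hij).mono (Finset.subset_insert _ _) (Finset.subset_insert _ _)

lemma StarFamily.center_injective : Function.Injective S.center := by
  intro i j h
  by_contra hij
  exact Finset.disjoint_left.1 (S.pairwise_disjoint i j hij) (Finset.mem_insert_self _ _)
    (h ▸ Finset.mem_insert_self _ _)

lemma StarFamily.card_biUnion_leaves (I : Finset ι) :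
    (I.biUnion S.leaves).card = I.card * s := by
  rw [Finset.card_biUnion fun i _ j _ hij => S.disjoint_leaves hij]
  simp [S.card_leaves]

lemma StarFamily.center_notMem (i : ι) : S.center i ∉ X :=
  Finset.disjoint_left.1 (S.disjoint_avoid i) (Finset.mem_insert_self _ _)

lemma StarFamily.adj {i : ι} {v : V} (hv : v ∈ S.leaves i) : G.Adj (S.center i) v := by
  simpa using S.leaves_subset i hv

end Lemmas

end Stars

/-! ### Construction of webs with disjoint interiors. -/

section Webs

variable {V : Type*} [Fintype V] [DecidableEq V] {G : SimpleGraph V} [DecidableRel G.Adj]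

/-- A web with centre `z`: `h` branches on at most `m` vertices, meeting only in `z`, the `i`-th of
which joins `z` to `hub i`, which in turn is adjacent to `s` leaves; distinct hubs have disjoint
sets of leaves. -/
structure Web (G : SimpleGraph V) (z : V) (h m s : ℕ) where
  hub : Fin h → V
  branch : Fin h → Finset V
  leaves : Fin h → Finset V
  joined : ∀ i, G.JoinedIn (branch i) z (hub i)
  card_branch : ∀ i, (branch i).card ≤ m
  branch_inter : ∀ i j, i ≠ j → branch i ∩ branch j ⊆ {z}
  adj : ∀ i, ∀ v ∈ leaves i, G.Adj (hub i) v
  card_leaves : ∀ i, (leaves i).card = s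
  disjoint_leaves : ∀ i j, i ≠ j → Disjoint (leaves i) (leaves j)

/-- The vertices on the branches of a web, with its centre. -/
def Web.interior {z : V} {h m s : ℕ} (T : G.Web z h m s) : Finset V :=
  insert z (Finset.univ.biUnion T.branch)

omit [Fintype V] [DecidableRel G.Adj] in
lemma Web.card_interior {z : V} {h m s : ℕ} (T : G.Web z h m s) :
    T.interior.card ≤ h * m + 1 := by
  refine (Finset.card_insert_le _ _).trans (Nat.add_le_add_right ?_ 1)
  exact (Finset.card_biUnion_le_card_mul _ _ m fun i _ => T.card_branch i).trans (by simp)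

/-- `k` disjoint connections, each from a leaf of a source star to a leaf of a target star, with
distinct targets. -/
structure Linkage {ι κ : Type*} {s : ℕ} {X : Finset V} (S : G.StarFamily (ι ⊕ κ) s X)
    (Y : Finset V) (m k : ℕ) where
  src : Fin k → ι
  tgt : Fin k → κ
  conn : Fin k → Finset V
  tgt_injective : Function.Injective tgt
  card_conn : ∀ i, (conn i).card ≤ m
  disjoint_avoid : ∀ i, Disjoint (conn i) Y
  disjoint_conn : ∀ i j, i ≠ j → Disjoint (conn i) (conn j)
  joined : ∀ i, ∃ a ∈ S.leaves (Sum.inl (src i)), ∃ b ∈ S.leaves (Sum.inr (tgt i)),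
    G.JoinedIn (conn i) a b

/-- Greedy choice: earlier connections are added to the forbidden set. Sources may be reused, and
the bound on `k` guarantees that at least `M` targets are still unused before each new connection,
so both leaf sets have at least `M * s` vertices. -/
lemma exists_linkage {s₀ r m s M T : ℕ} (hG : G.ConnectsAvoiding s₀ r m) {X : Finset V}
    (S : G.StarFamily (Fin M ⊕ Fin T) s X) (Y : Finset V) (k : ℕ) (hk : k + M ≤ T + 1)
    (hs₀ : s₀ ≤ M * s) (hY : r * (Y.card + k * m) ≤ M * s) :
    Nonempty (Linkage S Y m k) := by
  induction k with
  | zero =>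
    exact ⟨⟨fun i => i.elim0, fun i => i.elim0, fun i => i.elim0, fun i => i.elim0,
      fun i => i.elim0, fun i => i.elim0, fun i => i.elim0, fun i => i.elim0⟩⟩
  | succ k ih =>
    obtain ⟨K⟩ := ih (by omega) (le_trans (Nat.mul_le_mul_left _ (Nat.add_le_add_left
      (Nat.mul_le_mul_right _ (Nat.le_succ k)) _)) hY)
    set C := Finset.univ.biUnion K.conn with hC
    have hCc : C.card ≤ k * m :=
      (Finset.card_biUnion_le_card_mul _ _ m fun i _ => K.card_conn i).trans (by simp)
    set J : Finset (Fin T) := Finset.univ \ Finset.univ.image K.tgt with hJ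
    have hJc : M ≤ J.card := by
      have h1 : _ ≤ J.card :=
        Finset.le_card_sdiff (Finset.univ.image K.tgt) (Finset.univ : Finset (Fin T))
      have h2 : (Finset.univ.image K.tgt).card ≤ k := Finset.card_image_le.trans (by simp)
      simp only [Finset.card_univ, Fintype.card_fin] at h1
      omega
    have hA := S.card_biUnion_leaves (Finset.univ.map Function.Embedding.inl)
    have hB := S.card_biUnion_leaves (J.map Function.Embedding.inr)
    simp only [Finset.card_map, Finset.card_univ, Fintype.card_fin] at hA hB
    have hBM : M * s ≤ J.card * s := Nat.mul_le_mul_right _ hJc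
    have hYC : r * (Y ∪ C).card ≤ M * s := by
      refine le_trans (Nat.mul_le_mul_left _ ?_) hY
      refine (Finset.card_union_le _ _).trans (Nat.add_le_add_left (hCc.trans ?_) _)
      exact Nat.mul_le_mul_right _ (Nat.le_succ k)
    obtain ⟨a, ha, b, hb, F, hF, hFm, hFd⟩ := hG _ _ (Y ∪ C) (hs₀.trans hA.ge)
      ((hs₀.trans hBM).trans hB.ge) (hYC.trans hA.ge) ((hYC.trans hBM).trans hB.ge)
    simp only [Finset.mem_biUnion, Finset.mem_map, Finset.mem_univ, true_and] at ha hb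
    obtain ⟨-, ⟨i, rfl⟩, ha⟩ := ha
    obtain ⟨-, ⟨j, hjJ, rfl⟩, hb⟩ := hb
    have hj : ∀ i, j ≠ K.tgt i := by
      intro i hi
      simp [hJ, hi] at hjJ
    have hFC : ∀ i, Disjoint F (K.conn i) := fun i => hFd.mono_right
      ((Finset.subset_biUnion_of_mem K.conn (Finset.mem_univ i)).trans Finset.subset_union_right)
    refine ⟨⟨Fin.cons i K.src, Fin.cons j K.tgt, Fin.cons F K.conn, ?_, ?_, ?_, ?_, ?_⟩⟩
    · rw [Fin.cons_injective_iff]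
      exact ⟨fun ⟨x, hx⟩ => hj x hx.symm, K.tgt_injective⟩
    · exact Fin.cases hFm K.card_conn
    · exact Fin.cases (hFd.mono_right Finset.subset_union_left) K.disjoint_avoid
    · refine Fin.cases (Fin.cases (fun h => (h rfl).elim) fun j _ => hFC j)
        fun i => Fin.cases (fun _ => (hFC i).symm) fun j hij => ?_
      exact K.disjoint_conn i j (fun h => hij (by rw [h]))
    · exact Fin.cases ⟨a, ha, b, hb, hF⟩ K.joined

/-- By pigeonhole some source star starts `h` of the connections. Its centre is the centre of the
web and the target centres are the hubs. Since connections avoid all star centres, the branches meet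
only in the web's centre. -/
lemma exists_web_of_linkage {ι κ : Type*} [Fintype ι] [Fintype κ] [DecidableEq ι] {s m h k : ℕ}
    {X Y : Finset V} {S : G.StarFamily (ι ⊕ κ) s X} (K : Linkage S Y m k)
    (hXY : X ⊆ Y) (hcent : ∀ i, S.center i ∈ Y) (hι : 0 < Fintype.card ι)
    (hk : Fintype.card ι * h ≤ k) :
    ∃ z, ∃ T : G.Web z h (m + 2) s, Disjoint T.interior X := by
  have : Nonempty ι := Fintype.card_pos_iff.1 hι
  obtain ⟨i, hi⟩ := Fintype.exists_le_card_fiber_of_mul_le_card K.src (n := h) (by simpa using hk)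
  obtain ⟨e, he⟩ : ∃ e : Fin h → Fin k, Function.Injective e ∧ ∀ x, K.src (e x) = i := by
    set P := Finset.univ.filter fun x => K.src x = i with hP
    refine ⟨fun x => P.orderEmbOfFin rfl (Fin.castLE hi x), ?_, fun x => ?_⟩
    · exact (P.orderEmbOfFin rfl).injective.comp (Fin.castLE_injective hi)
    · exact (Finset.mem_filter.1 (P.orderEmbOfFin_mem rfl (Fin.castLE hi x))).2
  obtain ⟨he, hei⟩ := he
  set z := S.center (Sum.inl i) with hz
  have hcY : ∀ x, Disjoint (K.conn x) Y := K.disjoint_avoid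
  have hcentconn : ∀ x j, S.center j ∉ K.conn x := fun x j hj =>
    Finset.disjoint_left.1 (hcY x) hj (hcent j)
  refine ⟨z, ⟨fun x => S.center (Sum.inr (K.tgt (e x))),
    fun x => insert z (insert (S.center (Sum.inr (K.tgt (e x)))) (K.conn (e x))),
    fun x => S.leaves (Sum.inr (K.tgt (e x))), ?_, ?_, ?_, ?_, ?_, ?_⟩, ?_⟩
  · intro x
    obtain ⟨a, ha, b, hb, hab⟩ := K.joined (e x)
    rw [hei] at ha
    have hsub : K.conn (e x) ⊆
        insert z (insert (S.center (Sum.inr (K.tgt (e x)))) (K.conn (e x))) :=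
      (Finset.subset_insert _ _).trans (Finset.subset_insert _ _)
    refine ((JoinedIn.of_adj (S.adj ha) (Finset.mem_insert_self _ _) (hsub hab.left_mem)).trans
      (hab.mono hsub)).trans (JoinedIn.of_adj (S.adj hb).symm (hsub hab.right_mem) (by simp))
  · intro x
    refine (Finset.card_insert_le _ _).trans (Nat.add_le_add_right
      ((Finset.card_insert_le _ _).trans (Nat.add_le_add_right (K.card_conn _) 1)) 1)
  · intro x y hxy v hv
    have hexy : e x ≠ e y := he.ne hxy
    have hne : S.center (Sum.inr (K.tgt (e x))) ≠ S.center (Sum.inr (K.tgt (e y))) := fun h =>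
      hexy (K.tgt_injective (Sum.inr_injective (S.center_injective h)))
    simp only [Finset.mem_inter, Finset.mem_insert] at hv
    rw [Finset.mem_singleton]
    rcases hv with ⟨rfl | rfl | h1, h2⟩
    · rfl
    · rcases h2 with h2 | h2 | h2
      · exact h2
      · exact (hne h2).elim
      · exact (hcentconn _ _ h2).elim
    · rcases h2 with h2 | rfl | h2
      · exact h2
      · exact (hcentconn _ _ h1).elim
      · exact (Finset.disjoint_left.1 (K.disjoint_conn _ _ hexy) h1 h2).elim
  · intro x v hv
    exact S.adj hv
  · intro x
    exact S.card_leaves _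
  · intro x y hxy
    refine S.disjoint_leaves fun h => hxy (he (K.tgt_injective (Sum.inr_injective h)))
  · rw [Finset.disjoint_left]
    intro v hv hvX
    simp only [Web.interior, Finset.mem_insert, Finset.mem_biUnion, Finset.mem_univ,
      true_and] at hv
    rcases hv with rfl | ⟨x, rfl | rfl | hv⟩
    · exact S.center_notMem _ hvX
    · exact S.center_notMem _ hvX
    · exact S.center_notMem _ hvX
    · exact Finset.disjoint_left.1 (hcY _) hv (hXY hvX)

/-- Existence of a web whose branches avoid `X`, built from `M` candidate centres. -/
lemma exists_web_avoiding {s D s₀ r m h M : ℕ} (hs : 0 < s) (hmin : ∀ v, 2 * s ≤ G.degree v)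
    (hmax : ∀ v, G.degree v ≤ D * s) (hG : G.ConnectsAvoiding s₀ r m) (hM : 0 < M)
    (X : Finset V) (hX : (D + 1) * (X.card + (M * (h + 2)) * (s + 1)) < Fintype.card V)
    (hs₀ : s₀ ≤ M * s) (hr : r * (X.card + M * (h + 2) + M * h * m) ≤ M * s) :
    ∃ z, ∃ T : G.Web z h (m + 2) s, Disjoint T.interior X := by
  obtain ⟨S₀⟩ := exists_starFamily_fin hs hmin hmax X (M * (h + 2)) hX
  -- There are `M` sources and `M * (h + 1)` targets: `M * h` targets get used and `M` stay in
  -- reserve.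
  have hsum : M + M * (h + 1) = M * (h + 2) := by ring
  set S := S₀.comp (finSumFinEquiv.trans (finCongr hsum)).toEmbedding
  set Y := X ∪ Finset.univ.image S.center with hY
  have hYc : Y.card ≤ X.card + M * (h + 2) := by
    refine (Finset.card_union_le _ _).trans (Nat.add_le_add_left ?_ _)
    refine Finset.card_image_le.trans ?_
    simp [← hsum]
  obtain ⟨K⟩ := exists_linkage hG S Y (M * h) (by rw [mul_add]; omega) hs₀
    (le_trans (Nat.mul_le_mul_left _ (Nat.add_le_add_right hYc _)) hr)
  exact exists_web_of_linkage K Finset.subset_union_left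
    (fun i => Finset.mem_union_right _ (Finset.mem_image_of_mem _ (Finset.mem_univ i)))
    (by simpa using hM) (by simp)

omit [Fintype V] [DecidableRel G.Adj] in
/-- A set of `k` vertices which are centres of webs with disjoint interiors. -/
lemma exists_disjoint_webs {h m s B k : ℕ}
    (hweb : ∀ X : Finset V, X.card ≤ B → ∃ z, ∃ T : G.Web z h m s, Disjoint T.interior X)
    (hk : k * (h * m + 1) ≤ B) :
    ∃ Z : Finset V, Z.card = k ∧ ∃ T : ∀ z : V, z ∈ Z → G.Web z h m s,
      ∀ z hz w hw, z ≠ w → Disjoint (T z hz).interior (T w hw).interior := by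
  induction k with
  | zero => exact ⟨∅, rfl, fun z hz => by simp at hz, fun z hz => by simp at hz⟩
  | succ k ih =>
    obtain ⟨Z, hZ, T, hT⟩ := ih ((Nat.mul_le_mul_right _ (Nat.le_succ k)).trans hk)
    set X := Z.attach.biUnion fun z => (T z.1 z.2).interior with hX
    have hXc : X.card ≤ B := by
      refine le_trans (Finset.card_biUnion_le_card_mul _ _ (h * m + 1) fun z _ =>
        (T z.1 z.2).card_interior) ?_
      rw [Finset.card_attach, hZ]
      exact (Nat.mul_le_mul_right _ (Nat.le_succ k)).trans hk
    obtain ⟨z₀, T₀, hT₀⟩ := hweb X hXc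
    have hsub : ∀ z hz, Disjoint T₀.interior (T z hz).interior := fun z hz =>
      hT₀.mono_right (Finset.subset_biUnion_of_mem
        (fun z : {z // z ∈ Z} => (T z.1 z.2).interior) (Finset.mem_attach Z ⟨z, hz⟩))
    have hz₀ : z₀ ∉ Z := fun hz =>
      Finset.disjoint_left.1 (hsub z₀ hz) (Finset.mem_insert_self _ _) (Finset.mem_insert_self _ _)
    refine ⟨insert z₀ Z, by rw [Finset.card_insert_of_notMem hz₀, hZ],
      fun z hz => if hzz : z = z₀ then hzz ▸ T₀ else T z (Finset.mem_of_mem_insert_of_ne hz hzz),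
      ?_⟩
    intro z hz w hw hzw
    by_cases h1 : z = z₀
    · subst h1
      have h2 : w ≠ z := hzw.symm
      simpa [h2] using hsub w _
    · by_cases h2 : w = z₀
      · subst h2
        simpa [h1] using (hsub z _).symm
      · simpa [h1, h2] using hT z _ w _ hzw

end Webs

/-! ### Gluing and truncating paths. -/

section Walks

variable {V : Type*} {G : SimpleGraph V}

lemma Walk.IsPath.append_of_inter {x y z : V} {p : G.Walk x y} {q : G.Walk y z} (hp : p.IsPath)
    (hq : q.IsPath) (h : ∀ v ∈ p.support, v ∈ q.support → v = y) : (p.append q).IsPath := by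
  rw [Walk.isPath_def, Walk.support_append, List.nodup_append']
  have hq' := hq.support_nodup
  rw [← Walk.cons_tail_support, List.nodup_cons] at hq'
  refine ⟨hp.support_nodup, hq'.2, fun v hv hv' => ?_⟩
  have := h v hv (List.mem_of_mem_tail hv')
  exact hq'.1 (this ▸ hv')

lemma Walk.IsPath.isCycle_append_of_inter {x y : V} {p : G.Walk x y} {q : G.Walk y x}
    (hp : p.IsPath) (hq : q.IsPath) (h : ∀ v ∈ p.support, v ∈ q.support → v = x ∨ v = y)
    (hlen : 1 < p.length ∨ 1 < q.length) : (p.append q).IsCycle := by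
  have hp' := hp.support_nodup
  have hq' := hq.support_nodup
  rw [← Walk.cons_tail_support, List.nodup_cons] at hp' hq'
  refine hp.isCycle_append hq (fun v hv hv' => ?_) hlen
  rcases h v (List.mem_of_mem_tail hv) (List.mem_of_mem_tail hv') with rfl | rfl
  exacts [hp'.1 hv, hq'.1 hv']

/-- A path whose last vertex satisfies `P` has a final segment starting with the first vertex that
satisfies `P`. -/
lemma Walk.IsPath.exists_suffix {x y : V} {p : G.Walk x y} (hp : p.IsPath) (P : V → Prop)
    (hy : P y) : ∃ (z : V) (q : G.Walk z y), P z ∧ q.IsPath ∧ (∀ v ∈ q.support, v ∈ p.support) ∧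
      ∀ v ∈ p.support, v ∉ q.support → ¬ P v := by
  induction p with
  | nil => exact ⟨_, Walk.nil, hy, hp, fun v hv => hv, fun v hv hv' => (hv' hv).elim⟩
  | @cons u v w huv p ih =>
    by_cases hu : P u
    · exact ⟨u, Walk.cons huv p, hu, hp, fun v hv => hv, fun v hv hv' => (hv' hv).elim⟩
    · obtain ⟨z, q, h1, h2, h3, h4⟩ := ih ((Walk.cons_isPath_iff _ _).1 hp).1 hy
      refine ⟨z, q, h1, h2, fun a ha => by simp [h3 a ha], fun a ha ha' => ?_⟩
      rw [Walk.support_cons, List.mem_cons] at ha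
      rcases ha with rfl | ha
      exacts [hu, h4 a ha ha']

end Walks

/-! ### Branches surviving a forbidden set, and links between webs. -/

section Intact

variable {V : Type*} [DecidableEq V] {G : SimpleGraph V} {z : V} {h m s : ℕ}

/-- The branches of a web which meet `W` at most in the centre. -/
def Web.intact (T : G.Web z h m s) (W : Finset V) : Finset (Fin h) :=
  Finset.univ.filter fun i => Disjoint (T.branch i \ {z}) W

/-- Away from the centre the branches are disjoint, so each vertex of `W` spoils at most one of
them. -/
lemma Web.card_le_of_hit (T : G.Web z h m s) {W : Finset V} {S : Finset (Fin h)}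
    (hS : ∀ i ∈ S, ¬ Disjoint (T.branch i \ {z}) W) :
    S.card ≤ (W ∩ T.interior).card := by
  refine (Finset.card_le_card_biUnion (s := S) (f := fun i => (T.branch i \ {z}) ∩ W)
    ?_ fun i hi => ?_).trans (Finset.card_le_card ?_)
  · intro i _ j _ hij
    rw [Function.onFun, Finset.disjoint_left]
    intro v hv hv'
    simp only [Finset.mem_inter, Finset.mem_sdiff] at hv hv'
    exact hv.1.2 (T.branch_inter i j hij (Finset.mem_inter.2 ⟨hv.1.1, hv'.1.1⟩))
  · exact Finset.not_disjoint_iff_nonempty_inter.1 (hS i hi)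
  · intro v hv
    simp only [Finset.mem_biUnion, Finset.mem_inter, Finset.mem_sdiff] at hv
    obtain ⟨i, -, ⟨hv, -⟩, hW⟩ := hv
    exact Finset.mem_inter.2 ⟨hW, Finset.mem_insert_of_mem
      (Finset.mem_biUnion.2 ⟨i, Finset.mem_univ i, hv⟩)⟩

lemma Web.le_card_intact_add (T : G.Web z h m s) (W : Finset V) :
    h ≤ (T.intact W).card + (W ∩ T.interior).card := by
  have h1 := T.card_le_of_hit (W := W) (S := Finset.univ \ T.intact W) fun i hi => by
    simpa [intact] using hi
  have h2 := Finset.le_card_sdiff (T.intact W) Finset.univ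
  simp only [Finset.card_univ, Fintype.card_fin] at h2
  omega

lemma Web.card_intact_le_union (T : G.Web z h m s) (W F : Finset V) :
    (T.intact W).card ≤ (T.intact (W ∪ F)).card + F.card := by
  have h1 := T.card_le_of_hit (W := F) (S := T.intact W \ T.intact (W ∪ F)) fun i hi => by
    simp only [intact, Finset.mem_sdiff, Finset.mem_filter, Finset.mem_univ, true_and,
      Finset.disjoint_union_right, not_and] at hi
    exact hi.2 hi.1
  have h2 := Finset.le_card_sdiff (T.intact (W ∪ F)) (T.intact W)
  have h3 : (F ∩ T.interior).card ≤ F.card := Finset.card_le_card Finset.inter_subset_left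
  omega

lemma Web.branch_subset_interior (T : G.Web z h m s) (i : Fin h) : T.branch i ⊆ T.interior :=
  (Finset.subset_biUnion_of_mem T.branch (Finset.mem_univ i)).trans (Finset.subset_insert _ _)

lemma Web.center_mem_interior (T : G.Web z h m s) : z ∈ T.interior :=
  Finset.mem_insert_self _ _

/-- Allows connections to avoid all of `Z` at no cost: intactness ignores the centre, the only point
of `Z` in the interior. -/
lemma Web.intact_union_eq (T : G.Web z h m s) (W : Finset V) {Z : Finset V}
    (hZ : ∀ w ∈ Z, w ∈ T.interior → w = z) : T.intact (W ∪ Z) = T.intact W := by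
  ext i
  simp only [intact, Finset.mem_filter, Finset.mem_univ, true_and, Finset.disjoint_union_right,
    and_iff_left_iff_imp]
  intro _
  rw [Finset.disjoint_left]
  intro v hv hvZ
  obtain ⟨hv, hvz⟩ := Finset.mem_sdiff.1 hv
  exact hvz (Finset.mem_singleton.2 (hZ v hvZ (T.branch_subset_interior i hv)))

lemma Web.card_biUnion_leaves (T : G.Web z h m s) (I : Finset (Fin h)) :
    (I.biUnion T.leaves).card = I.card * s := by
  rw [Finset.card_biUnion fun i _ j _ hij => T.disjoint_leaves i j hij]
  simp [T.card_leaves]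

/-- The branch of a web together with an adjacent connection at its hub. -/
lemma Web.joinedIn_of_leaf (T : G.Web z h m s) {i : Fin h} {a b : V} {F : Finset V}
    (ha : a ∈ T.leaves i) (hF : G.JoinedIn F a b) : G.JoinedIn (T.branch i ∪ F) z b :=
  (((T.joined i).mono Finset.subset_union_left).trans (JoinedIn.of_adj (T.adj i a ha)
    (Finset.mem_union_left _ (T.joined i).right_mem)
    (Finset.mem_union_right _ hF.left_mem))).trans (hF.mono Finset.subset_union_right)

lemma Web.eq_center_of_mem_branch (T : G.Web z h m s) {W : Finset V} {i : Fin h}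
    (hi : i ∈ T.intact W) {v : V} (hv : v ∈ T.branch i) (hvW : v ∈ W) : v = z := by
  by_contra hvz
  exact Finset.disjoint_left.1 (Finset.mem_filter.1 hi).2
    (Finset.mem_sdiff.2 ⟨hv, by simpa using hvz⟩) hvW

/-- The centres of two webs with many intact branches are joined by a short path avoiding `W`. -/
lemma exists_path_between_webs [Fintype V] {s₀ r n k : ℕ}
    (hG : G.ConnectsAvoiding s₀ r n) {y z : V} (T : G.Web y h m s) (T' : G.Web z h m s)
    (W : Finset V) (hT : k ≤ (T.intact W).card) (hT' : k ≤ (T'.intact W).card)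
    (hs₀ : s₀ ≤ k * s) (hW : r * W.card ≤ k * s) :
    ∃ q : G.Walk y z, q.IsPath ∧ (∀ v ∈ q.support, v ∈ W → v = y ∨ v = z) ∧
      q.support.toFinset.card ≤ 2 * m + n := by
  have h1 : k * s ≤ ((T.intact W).biUnion T.leaves).card := by
    rw [T.card_biUnion_leaves]; exact Nat.mul_le_mul_right _ hT
  have h2 : k * s ≤ ((T'.intact W).biUnion T'.leaves).card := by
    rw [T'.card_biUnion_leaves]; exact Nat.mul_le_mul_right _ hT'
  obtain ⟨a, ha, b, hb, F, hF, hFn, hFW⟩ := hG _ _ W (hs₀.trans h1) (hs₀.trans h2)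
    (hW.trans h1) (hW.trans h2)
  obtain ⟨i, hi, ha⟩ := Finset.mem_biUnion.1 ha
  obtain ⟨j, hj, hb⟩ := Finset.mem_biUnion.1 hb
  obtain ⟨q, hq, hqF⟩ :=
    (T'.joinedIn_of_leaf hb (T.joinedIn_of_leaf ha hF).symm).symm.exists_isPath
  refine ⟨q, hq, fun v hv hvW => ?_, ?_⟩
  · have := hqF v hv
    simp only [Finset.mem_union] at this
    rcases this with h | h | h
    · exact Or.inr (T'.eq_center_of_mem_branch hj h hvW)
    · exact Or.inl (T.eq_center_of_mem_branch hi h hvW)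
    · exact (Finset.disjoint_left.1 hFW h hvW).elim
  · have h3 : q.support.toFinset ⊆ T'.branch j ∪ (T.branch i ∪ F) := fun v hv =>
      hqF v (List.mem_toFinset.1 hv)
    have h4 := Finset.card_le_card h3
    have h5 := Finset.card_union_le (T'.branch j) (T.branch i ∪ F)
    have h6 := Finset.card_union_le (T.branch i) F
    have h7 := T.card_branch i
    have h8 := T'.card_branch j
    omega

end Intact

/-! ### The path through the centres and its closure to a cycle. -/

section Cycle

variable {V : Type*} [Fintype V] [DecidableEq V] {G : SimpleGraph V} {h m s : ℕ}
  {Z : Finset V} (T : ∀ z : V, z ∈ Z → G.Web z h m s)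

omit [Fintype V] in
/-- Few of the webs have fewer than half of their branches intact. -/
lemma card_mul_le_of_not_intact
    (hT : ∀ z hz w hw, z ≠ w → Disjoint (T z hz).interior (T w hw).interior) (W B : Finset V)
    (hB : ∀ z ∈ B, ∃ hz : z ∈ Z, 2 * ((T z hz).intact W).card ≤ h) :
    B.card * h ≤ 2 * W.card := by
  choose hBZ hB using hB
  have h1 : ∀ z : {z // z ∈ B}, h ≤ 2 * (W ∩ (T z.1 (hBZ _ z.2)).interior).card := fun z => by
    have := (T z.1 (hBZ _ z.2)).le_card_intact_add W
    have := hB z.1 z.2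
    omega
  have h2 : ∑ z ∈ B.attach, (W ∩ (T z.1 (hBZ _ z.2)).interior).card ≤ W.card := by
    rw [← Finset.card_biUnion]
    · exact Finset.card_le_card (Finset.biUnion_subset.2 fun z _ => Finset.inter_subset_left)
    · intro z _ w _ hzw
      exact (hT _ _ _ _ fun h => hzw (Subtype.ext h)).mono Finset.inter_subset_right
        Finset.inter_subset_right
  calc B.card * h = ∑ z ∈ B.attach, h := by simp
    _ ≤ ∑ z ∈ B.attach, 2 * (W ∩ (T z.1 (hBZ _ z.2)).interior).card :=
        Finset.sum_le_sum fun z _ => h1 z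
    _ ≤ 2 * W.card := by rw [← Finset.mul_sum]; omega

omit [Fintype V] in
lemma eq_of_mem_interior
    (hT : ∀ z hz w hw, z ≠ w → Disjoint (T z hz).interior (T w hw).interior) {z : V} (hz : z ∈ Z) :
    ∀ w ∈ Z, w ∈ (T z hz).interior → w = z := by
  intro w hw hwz
  by_contra hne
  exact Finset.disjoint_left.1 (hT w hw z hz hne) (T w hw).center_mem_interior hwz

omit [Fintype V] in
lemma not_intact_of_card_lt {T : ∀ z : V, z ∈ Z → G.Web z h m s}
    (hT : ∀ z hz w hw, z ≠ w → Disjoint (T z hz).interior (T w hw).interior) {W B : Finset V}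
    {b : ℕ} (hW : 2 * W.card < (b + 1) * h)
    (hB : ∀ z ∈ B, ∃ hz : z ∈ Z, 2 * ((T z hz).intact W).card ≤ h) : B.card ≤ b := by
  have := card_mul_le_of_not_intact T hT W B hB
  by_contra! hlt
  have : (b + 1) * h ≤ B.card * h := Nat.mul_le_mul_right _ hlt
  omega

/-- A path visiting `k` centres, all in `U`, whose last web has many intact branches. -/
lemma exists_path_through_webs {s₀ r n k₀ ℓ b K : ℕ}
    (hT : ∀ z hz w hw, z ≠ w → Disjoint (T z hz).interior (T w hw).interior)
    (hG : G.ConnectsAvoiding s₀ r n) (hℓ : 2 * m + n ≤ ℓ) (hℓ1 : 1 ≤ ℓ) (hh : 2 * (k₀ + ℓ) ≤ h)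
    (hs₀ : s₀ ≤ k₀ * s) (hr : r * (K * ℓ + Z.card) ≤ k₀ * s) (hb : 2 * (K * ℓ) < (b + 1) * h)
    {U : Finset V} (hUZ : U ⊆ Z) (hU : K + b < U.card) (k : ℕ) (hk1 : 1 ≤ k) (hk : k ≤ K) :
    ∃ (x y : V) (p : G.Walk x y) (hy : y ∈ Z), p.IsPath ∧
      p.support.toFinset ∩ Z ⊆ U ∧ (p.support.toFinset ∩ Z).card = k ∧
      p.support.toFinset.card ≤ k * ℓ ∧ k₀ ≤ ((T y hy).intact p.support.toFinset).card := by
  induction k, hk1 using Nat.le_induction with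
  | base =>
    obtain ⟨z, hz⟩ : U.Nonempty := Finset.card_pos.1 (by omega)
    have hzZ := hUZ hz
    have hsupp : (Walk.nil : G.Walk z z).support.toFinset = {z} := by simp
    refine ⟨z, z, Walk.nil, hzZ, Walk.IsPath.nil, ?_⟩
    rw [hsupp, Finset.singleton_inter_of_mem hzZ]
    refine ⟨by simpa using hz, by simp, by simpa using hℓ1, ?_⟩
    have h1 := (T z hzZ).le_card_intact_add {z}
    have h2 : ({z} ∩ (T z hzZ).interior).card ≤ 1 :=
      (Finset.card_le_card Finset.inter_subset_left).trans (by simp)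
    omega
  | succ k hk1 ih =>
    obtain ⟨x, y, p, hy, hp, hpU, hpc, hpℓ, hpk⟩ := ih (by omega)
    set W := p.support.toFinset with hWdef
    have hkK : k * ℓ ≤ K * ℓ := Nat.mul_le_mul_right _ (by omega)
    -- More than `b` vertices of `U` are unvisited, and at most `b` webs have lost half of their
    -- branches.
    obtain ⟨z, hzU, hzZ, hzW, hzI⟩ : ∃ z ∈ U, ∃ hz : z ∈ Z, z ∉ W ∧
        h < 2 * ((T z hz).intact W).card := by
      by_contra! hcon
      have h1 := not_intact_of_card_lt hT (W := W) (B := U \ W) (b := b) (by omega) fun z hz =>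
        ⟨hUZ (Finset.mem_sdiff.1 hz).1, hcon z (Finset.mem_sdiff.1 hz).1
          (hUZ (Finset.mem_sdiff.1 hz).1) (Finset.mem_sdiff.1 hz).2⟩
      have h2 := Finset.card_sdiff_add_card_inter U W
      have h3 : (U ∩ W).card ≤ (W ∩ Z).card := by
        rw [Finset.inter_comm]
        exact Finset.card_le_card (Finset.inter_subset_inter_left hUZ)
      omega
    obtain ⟨q, hq, hqW, hqc⟩ := exists_path_between_webs hG (T y hy) (T z hzZ) (W ∪ Z)
      (k := k₀) (by rwa [Web.intact_union_eq _ _ (eq_of_mem_interior T hT hy)])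
      (by rw [Web.intact_union_eq _ _ (eq_of_mem_interior T hT hzZ)]; omega) hs₀
      (le_trans (Nat.mul_le_mul_left _ ((Finset.card_union_le _ _).trans (by omega))) hr)
    have hyW : y ∈ W := by simp [hWdef]
    have hsupp : (p.append q).support.toFinset = W ∪ q.support.toFinset := by
      ext v
      simp [hWdef, Walk.mem_support_append_iff]
    have hinter : (W ∪ q.support.toFinset) ∩ Z = insert z (W ∩ Z) := by
      ext v
      simp only [Finset.mem_inter, Finset.mem_union, Finset.mem_insert, List.mem_toFinset]
      constructor
      · rintro ⟨hv | hv, hvZ⟩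
        · exact Or.inr ⟨hv, hvZ⟩
        · rcases hqW v hv (Finset.mem_union_right _ hvZ) with rfl | rfl
          · exact Or.inr ⟨hyW, hvZ⟩
          · exact Or.inl rfl
      · rintro (rfl | ⟨hv, hvZ⟩)
        · exact ⟨Or.inr q.end_mem_support, hzZ⟩
        · exact ⟨Or.inl hv, hvZ⟩
    refine ⟨x, z, p.append q, hzZ, hp.append_of_inter hq fun v hv hv' => ?_, ?_⟩
    · have hvW : v ∈ W := List.mem_toFinset.2 hv
      rcases hqW v hv' (Finset.mem_union_left _ hvW) with rfl | rfl
      · rfl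
      · exact (hzW hvW).elim
    · rw [hsupp, hinter]
      refine ⟨Finset.insert_subset hzU hpU, ?_, ?_, ?_⟩
      · rw [Finset.card_insert_of_notMem fun hz => hzW (Finset.mem_inter.1 hz).1, hpc]
      · refine (Finset.card_union_le _ _).trans ?_
        rw [add_mul, one_mul]
        omega
      · have := (T z hzZ).card_intact_le_union W q.support.toFinset
        omega

/-- A cycle meeting `Z` only in `U`, and in all but few vertices of `U`. -/
lemma exists_cycle_through_webs {s₀ r n k₀ ℓ b K : ℕ}
    (hT : ∀ z hz w hw, z ≠ w → Disjoint (T z hz).interior (T w hw).interior)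
    (hG : G.ConnectsAvoiding s₀ r n) (hℓ : 2 * m + n ≤ ℓ) (hℓ1 : 1 ≤ ℓ) (hh : 2 * (k₀ + ℓ) ≤ h)
    (hs₀ : s₀ ≤ k₀ * s) (hr : r * (K * ℓ + Z.card) ≤ k₀ * s) (hb : 2 * (K * ℓ) < (b + 1) * h)
    {U : Finset V} (hUZ : U ⊆ Z) (hU : K + b < U.card) (hK : b + 3 ≤ K) :
    ∃ (v : V) (C : G.Walk v v), C.IsCycle ∧ C.support.toFinset ∩ Z ⊆ U ∧
      K ≤ (C.support.toFinset ∩ Z).card + b := by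
  obtain ⟨x, y, p, hy, hp, hpU, hpc, hpℓ, hpk⟩ := exists_path_through_webs T hT hG hℓ hℓ1 hh hs₀
    hr hb hUZ hU K (by omega) le_rfl
  set W := p.support.toFinset with hWdef
  -- The path is cut at its first centre whose web is still usable. The centres discarded are all
  -- unusable, hence at most `b` in number.
  obtain ⟨z, q, ⟨hz, hzk⟩, hq, hqp, hbad⟩ :=
    hp.exists_suffix (fun v => ∃ hv : v ∈ Z, k₀ ≤ ((T v hv).intact W).card) ⟨hy, hpk⟩
  have hB := not_intact_of_card_lt hT (W := W) (B := (W ∩ Z) \ q.support.toFinset) (b := b)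
    (by omega) fun v hv => by
      simp only [Finset.mem_sdiff, Finset.mem_inter, List.mem_toFinset, hWdef] at hv
      have h1 := hbad v hv.1.1 hv.2
      push Not at h1
      exact ⟨hv.1.2, by have := h1 hv.1.2; omega⟩
  have hqW : q.support.toFinset ⊆ W := fun v hv => by
    simpa [hWdef] using hqp v (by simpa using hv)
  have hcount : K ≤ (q.support.toFinset ∩ Z).card + b := by
    have h1 := Finset.card_sdiff_add_card_inter (W ∩ Z) q.support.toFinset
    have h2 : (W ∩ Z) ∩ q.support.toFinset ⊆ q.support.toFinset ∩ Z := fun v hv => by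
      simp only [Finset.mem_inter] at hv ⊢
      exact ⟨hv.2, hv.1.2⟩
    have h3 := Finset.card_le_card h2
    omega
  -- The closing link may be a single edge, so the retained path must itself have length at least
  -- two.
  have hqlen : 2 ≤ q.length := by
    have h1 : (q.support.toFinset ∩ Z).card ≤ q.support.toFinset.card :=
      Finset.card_le_card Finset.inter_subset_left
    have h2 := List.toFinset_card_le q.support
    rw [Walk.length_support] at h2
    omega
  obtain ⟨c, hc, hcW, -⟩ := exists_path_between_webs hG (T y hy) (T z hz) (W ∪ Z)
    (k := k₀) (by rwa [Web.intact_union_eq _ _ (eq_of_mem_interior T hT hy)])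
    (by rwa [Web.intact_union_eq _ _ (eq_of_mem_interior T hT hz)]) hs₀
    (le_trans (Nat.mul_le_mul_left _ ((Finset.card_union_le _ _).trans (by omega))) hr)
  have hsupp : (q.append c).support.toFinset ∩ Z = q.support.toFinset ∩ Z := by
    ext v
    simp only [Finset.mem_inter, List.mem_toFinset, Walk.mem_support_append_iff,
      and_congr_left_iff, or_iff_left_iff_imp]
    intro hvZ hv
    rcases hcW v hv (Finset.mem_union_right _ hvZ) with rfl | rfl
    exacts [q.end_mem_support, q.start_mem_support]
  refine ⟨z, q.append c, hq.isCycle_append_of_inter hc (fun v hv hv' => ?_) (Or.inl hqlen), ?_⟩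
  · exact (hcW v hv' (Finset.mem_union_left _ (hqW (by simpa using hv)))).symm
  · rw [hsupp]
    exact ⟨(Finset.inter_subset_inter_right hqW).trans hpU, hcount⟩

end Cycle

end SimpleGraph

/-! ### Choice of parameters and the final estimates. -/

/-- The combinatorial core: degrees between `2 * s` and `Q * s`, expansion by a factor `1 / Q ^ 3`
from size `s` on, and `s` and `|V| / s` at least suitable powers of `Q`. -/
lemma SimpleGraph.exists_set_with_cycles {V : Type*} [Fintype V] [DecidableEq V]
    {G : SimpleGraph V} [DecidableRel G.Adj] {Q s zc uc b K : ℕ} (hQ : 200 ≤ Q)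
    (hs : Q ^ 23 ≤ s) (hn : Q ^ 40 * s ≤ Fintype.card V) (hmin : ∀ v, 2 * s ≤ G.degree v)
    (hmax : ∀ v, G.degree v ≤ Q * s)
    (hexp : ∀ X : Finset V, s ≤ X.card → 2 * X.card ≤ Fintype.card V →
      X.card ≤ Q ^ 3 * (G.extNeighborFinset X).card)
    (hgrow : (Fintype.card V : ℝ) < 2 * (s * (1 + 1 / (2 * (Q : ℝ) ^ 3)) ^ (4 * Q ^ 4)))
    (hzc : zc ≤ 8000 * s) (hb : s ≤ 8 * (b + 1)) (hK : K ≤ 4000 * s) (hKb : K + b < uc)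
    (hbK : b + 3 ≤ K) :
    ∃ Z : Finset V, Z.card = zc ∧ ∀ U : Finset V, U ⊆ Z → U.card = uc →
      ∃ (v : V) (C : G.Walk v v), C.IsCycle ∧ C.support.toFinset ∩ Z ⊆ U ∧
        K ≤ (C.support.toFinset ∩ Z).card + b := by
  have hQ0 : 0 < Q := by omega
  -- Each extra power of `Q` absorbs a numerical factor `200`; the remaining inequalities compare
  -- exponents in this way.
  have hP : ∀ i j, i < j → 200 * Q ^ i ≤ Q ^ j := fun i j hij =>
    calc 200 * Q ^ i ≤ Q ^ i * Q := by rw [mul_comm]; exact Nat.mul_le_mul_left _ hQ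
      _ = Q ^ (i + 1) := (pow_succ _ _).symm
      _ ≤ Q ^ j := Nat.pow_le_pow_right hQ0 hij
  have hS : ∀ i j, i < j → 200 * (Q ^ i * s) ≤ Q ^ j * s := fun i j hij => by
    rw [← mul_assoc]; exact Nat.mul_le_mul_right _ (hP i j hij)
  have hQs : Q ^ 46 ≤ Q ^ 23 * s := by
    rw [show 46 = 23 + 23 by norm_num, pow_add]; exact Nat.mul_le_mul_left _ hs
  have h23 : 1 ≤ Q ^ 23 := Nat.one_le_pow _ _ hQ0
  have hs1 : 1 ≤ s := h23.trans hs
  have hG : G.ConnectsAvoiding (2 * s) (4 * Q ^ 3) (2 * (4 * Q ^ 4) + 2) :=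
    connectsAvoiding_of_expansion (by positivity) hexp (by exact_mod_cast hgrow)
  have h4 : 1 ≤ Q ^ 4 := Nat.one_le_pow _ _ hQ0
  have h5 := hP 4 5 (by norm_num)
  -- `Q ^ 19 * s` exceeds the total size of at most `8000 * s` interiors. Taking `Q ^ 24` candidate
  -- centres gives enough leaves to outweigh such an `X` by the factor `4 * Q ^ 3`.
  have hweb : ∀ X : Finset V, X.card ≤ Q ^ 19 * s →
      ∃ z, ∃ T : G.Web z (Q ^ 12) (2 * (4 * Q ^ 4) + 2 + 2) s, Disjoint T.interior X := by
    intro X hX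
    refine exists_web_avoiding (M := Q ^ 24) hs1 hmin hmax hG (by positivity) X ?_ ?_ ?_
    · refine lt_of_lt_of_le ?_ hn
      calc (Q + 1) * (X.card + Q ^ 24 * (Q ^ 12 + 2) * (s + 1))
          ≤ (Q + Q) * (Q ^ 19 * s + Q ^ 24 * (Q ^ 12 + 2) * (s + s)) := by gcongr; omega
        _ < Q ^ 40 * s := by
          have h1 := hS 20 37 (by norm_num)
          have h2 := hS 25 37 (by norm_num)
          have h3 := hS 37 38 (by norm_num)
          have h4 := hS 38 40 (by norm_num)
          have h5 : 0 < Q ^ 37 * s := by positivity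
          linarith
    · have := hS 0 24 (by norm_num)
      linarith
    · calc 4 * Q ^ 3 * (X.card + Q ^ 24 * (Q ^ 12 + 2) + Q ^ 24 * Q ^ 12 * (2 * (4 * Q ^ 4) + 2))
          ≤ 4 * Q ^ 3 * (Q ^ 19 * s + Q ^ 24 * (Q ^ 12 + 2) +
              Q ^ 24 * Q ^ 12 * (2 * (4 * Q ^ 4) + 2)) := by gcongr
        _ ≤ Q ^ 24 * s := by
          have h1 := hS 23 24 (by norm_num)
          have h2 := hS 22 23 (by norm_num)
          have h3 := hQs
          have h4 := hP 39 46 (by norm_num)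
          have h5 := hP 27 46 (by norm_num)
          have h6 := hP 43 46 (by norm_num)
          have h7 : 0 < Q ^ 46 := by positivity
          linarith
  obtain ⟨Z, hZ, T, hT⟩ := exists_disjoint_webs (k := zc) hweb (by
    calc zc * (Q ^ 12 * (2 * (4 * Q ^ 4) + 2 + 2) + 1)
        ≤ 8000 * s * (Q ^ 12 * (2 * (4 * Q ^ 4) + 2 + 2) + 1) := by gcongr
      _ ≤ Q ^ 19 * s := by
        have h1 := hS 16 17 (by norm_num)
        have h2 := hS 17 18 (by norm_num)
        have h3 := hS 18 19 (by norm_num)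
        have h4 := hS 12 16 (by norm_num)
        have h6 : 0 < Q ^ 16 * s := by positivity
        have h5 := hS 0 16 (by norm_num)
        linarith)
  refine ⟨Z, hZ, fun U hUZ hU => ?_⟩
  -- A link has at most `24 * Q ^ 4 + 10 ≤ Q ^ 5` vertices. `Q ^ 11` branches carry enough leaves to
  -- bypass the whole path together with `Z`, yet are a small fraction of the `Q ^ 12` branches of a
  -- web.
  refine exists_cycle_through_webs T hT hG (k₀ := Q ^ 11) (ℓ := Q ^ 5) ?_ (by linarith) ?_ ?_ ?_ ?_
    hUZ (by omega) hbK
  · linarith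
  · have h1 := hP 11 12 (by norm_num)
    have h2 := hP 5 11 (by norm_num)
    linarith
  · have := hS 0 11 (by norm_num)
    linarith
  · calc 4 * Q ^ 3 * (K * Q ^ 5 + Z.card)
        ≤ 4 * Q ^ 3 * (4000 * s * Q ^ 5 + 8000 * s) := by gcongr; omega
      _ ≤ Q ^ 11 * s := by
        have h1 := hS 8 9 (by norm_num)
        have h2 := hS 9 10 (by norm_num)
        have h3 := hS 10 11 (by norm_num)
        have h4 := hS 3 8 (by norm_num)
        have h5 : 0 < Q ^ 8 * s := by positivity
        linarith
  · calc 2 * (K * Q ^ 5) ≤ 2 * (4000 * (8 * (b + 1)) * Q ^ 5) := by gcongr; omega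
      _ < (b + 1) * Q ^ 12 := by
        have h1 : 64000 * Q ^ 5 < Q ^ 12 := by
          have h1 := hP 5 6 (by norm_num)
          have h2 := hP 6 7 (by norm_num)
          have h3 := hP 7 8 (by norm_num)
          have h4 := hP 8 12 (by norm_num)
          linarith
        calc 2 * (4000 * (8 * (b + 1)) * Q ^ 5) = (b + 1) * (64000 * Q ^ 5) := by ring
          _ < (b + 1) * Q ^ 12 := by gcongr

/-- A uniform lower bound for the expansion in terms of the order of the graph. -/
lemma SimpleGraph.IsExpander.card_le_mul {V : Type*} [Fintype V] [DecidableEq V]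
    {G : SimpleGraph V} [DecidableRel G.Adj] {ε₁ d : ℝ} {Q : ℕ} (hε₁ : 0 < ε₁) (hd : 0 < d)
    (hG : G.IsExpander ε₁ (d / 30)) (hQ : Real.log (450 * Fintype.card V / d) ≤ Q)
    (hQε : 1 / ε₁ ≤ Q) {X : Finset V} (hX : d / 40 ≤ X.card)
    (hX' : 2 * X.card ≤ Fintype.card V) :
    X.card ≤ Q ^ 3 * (G.extNeighborFinset X).card := by
  have hX'' : 2 * (X.card : ℝ) ≤ Fintype.card V := by exact_mod_cast hX'
  -- With `t = d / 30`, the bound `d / 40` exceeds both thresholds `t / 2 = d / 60` and `t / 5 = d /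
  -- 150`.
  have h1 := hG X (by linarith) (by linarith)
  rw [expansionRate, if_neg (by linarith)] at h1
  have hQ0 : (0 : ℝ) < Q := lt_of_lt_of_le (by positivity) hQε
  have harg : 15 * (X.card : ℝ) / (d / 30) = 450 * X.card / d := by field_simp; ring
  rw [harg] at h1
  have hone : 1 < 450 * (X.card : ℝ) / d := by
    rw [one_lt_div hd]; linarith
  have hlog : 0 < Real.log (450 * X.card / d) := Real.log_pos hone
  have hlogQ : Real.log (450 * X.card / d) ≤ Q := by
    refine (Real.log_le_log (by linarith) ?_).trans hQ
    gcongr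
    linarith
  have h2 : 1 / (Q : ℝ) ^ 3 ≤ ε₁ / Real.log (450 * X.card / d) ^ 2 := by
    calc 1 / (Q : ℝ) ^ 3 = (1 / Q) / Q ^ 2 := by field_simp
      _ ≤ ε₁ / Q ^ 2 := by
        gcongr
        rw [div_le_iff₀ hQ0]
        rwa [div_le_iff₀ hε₁, mul_comm] at hQε
      _ ≤ _ := by gcongr
  have h3 : 1 / (Q : ℝ) ^ 3 * X.card ≤ (G.extNeighborFinset X).card :=
    (mul_le_mul_of_nonneg_right h2 (Nat.cast_nonneg _)).trans h1
  rw [one_div_mul_eq_div, div_le_iff₀ (by positivity)] at h3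
  have h4 : (X.card : ℝ) ≤ Q ^ 3 * (G.extNeighborFinset X).card := by linarith
  exact_mod_cast h4

/-- By Bernoulli, `2 * Q ^ 3` factors already give at least `2`; repeating this `2 * Q` times gives
`4 ^ Q`, which beats `e ^ Q`. -/
lemma exp_le_one_add_pow {Q : ℕ} (hQ : 0 < Q) {q : ℝ} (hq : q ≤ Q) :
    Real.exp q ≤ (1 + 1 / (2 * (Q : ℝ) ^ 3)) ^ (4 * Q ^ 4) := by
  have h1 : (2 : ℝ) ≤ (1 + 1 / (2 * (Q : ℝ) ^ 3)) ^ (2 * Q ^ 3) := by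
    have h2 := one_add_mul_le_pow (a := 1 / (2 * (Q : ℝ) ^ 3))
      (le_trans (by norm_num) (by positivity : (0 : ℝ) ≤ 1 / (2 * (Q : ℝ) ^ 3))) (2 * Q ^ 3)
    have h3 : ((2 * Q ^ 3 : ℕ) : ℝ) * (1 / (2 * (Q : ℝ) ^ 3)) = 1 := by
      push_cast
      field_simp
    rw [h3] at h2
    linarith
  calc Real.exp q ≤ Real.exp Q := Real.exp_le_exp.2 hq
    _ = Real.exp 1 ^ Q := by rw [← Real.exp_nat_mul, mul_one]
    _ ≤ ((2 : ℝ) ^ 2) ^ Q := by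
      have := Real.exp_one_lt_d9
      gcongr
      linarith
    _ ≤ (((1 + 1 / (2 * (Q : ℝ) ^ 3)) ^ (2 * Q ^ 3)) ^ 2) ^ Q := by gcongr
    _ = _ := by rw [← pow_mul, ← pow_mul]; congr 1; ring

theorem theorem1p4 (ε₁ L : ℝ) (hε₁ : 0 < ε₁) (hε₁' : ε₁ ≤ 1) (hL : 1 ≤ L) :
    ∃ d₀ K₀ : ℝ, ∀ (d K : ℝ) (n : ℕ), d₀ ≤ d → K₀ ≤ K →
      (Real.log (n : ℝ)) ^ 100 ≤ d → d ≤ (n : ℝ) / K →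
      ∀ (V : Type*) [Fintype V] [DecidableEq V] (H : SimpleGraph V) [DecidableRel H.Adj],
        Fintype.card V = n →
        H.IsExpander ε₁ (d / 30) →
        d / 10 ≤ (H.minDegree : ℝ) → (H.maxDegree : ℝ) ≤ L * d →
        ∃ Z : Finset V, Z.card = ⌊200 * d⌋₊ ∧
          ∀ U : Finset V, U ⊆ Z → U.card = ⌊100 * d⌋₊ →
            ∃ (v : V) (C : H.Walk v v), C.IsCycle ∧
              C.support.toFinset ∩ Z ⊆ U ∧
              98 * d ≤ ((C.support.toFinset ∩ Z).card : ℝ) := by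
  obtain ⟨C₁, hC₁⟩ : ∃ C₁ : ℝ, ∀ q ≥ C₁, q ^ 82 ≤ Real.exp q := by
    have := (Real.isLittleO_pow_exp_atTop (n := 82)).bound one_pos
    obtain ⟨C₁, h⟩ := Filter.eventually_atTop.1 this
    refine ⟨C₁, fun q hq => (le_abs_self _).trans ?_⟩
    simpa using h q hq
  -- These lower bounds on `q` serve in turn for `Q ^ 40 * s ≤ n`, for the maximum degree, for
  -- absorbing `ε₁` into the third power of `Q`, and for numerical constants.
  obtain ⟨c, hc1, hcL, hcε, hc200⟩ : ∃ c : ℝ, C₁ ≤ c ∧ 40 * L ≤ c ∧ 1 / ε₁ ≤ c ∧ 450 ≤ c :=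
    ⟨max (max C₁ (40 * L)) (max (1 / ε₁) 450), by simp, by simp, by simp, by simp⟩
  refine ⟨450, Real.exp c, fun d K n hd hK hlog hdK V _ _ H _ hV hH hmin hmax => ?_⟩
  subst hV
  have hd0 : 0 < d := by linarith
  have hK0 : 0 < K := (Real.exp_pos c).trans_le hK
  have hKn : K * d ≤ Fintype.card V := by
    rw [le_div_iff₀ hK0] at hdK; linarith
  have hn0 : (0 : ℝ) < Fintype.card V := (mul_pos hK0 hd0).trans_le hKn
  set q := Real.log (450 * Fintype.card V / d) with hq
  have hexpq : Real.exp q = 450 * Fintype.card V / d := Real.exp_log (by positivity)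
  have hcq : c ≤ q := by
    rw [← Real.exp_le_exp, hexpq, le_div_iff₀ hd0]
    have := mul_le_mul_of_nonneg_right hK hd0.le
    linarith
  have hqn : q ≤ Real.log (Fintype.card V) := by
    refine Real.log_le_log (by positivity) ?_
    rw [div_le_iff₀ hd0, mul_comm]
    gcongr
  set Q := ⌈q⌉₊ with hQdef
  have hqQ : q ≤ Q := Nat.le_ceil q
  have hQq : (Q : ℝ) ≤ q ^ 2 := by
    have := (Nat.ceil_lt_add_one (by linarith : 0 ≤ q)).le
    nlinarith
  have hq1 : 1 ≤ q := by linarith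
  set s := ⌈d / 40⌉₊ with hsdef
  have hds : d / 40 ≤ s := Nat.le_ceil _
  have hsd : (s : ℝ) ≤ d / 40 + 1 := (Nat.ceil_lt_add_one (by positivity)).le
  have hQ200 : 200 ≤ Q := by
    have : (200 : ℝ) ≤ Q := by linarith
    exact_mod_cast this
  have hfl := Nat.floor_le (by positivity : 0 ≤ 100 * d)
  have hfl' := Nat.lt_floor_add_one (100 * d)
  have hfl2 := Nat.floor_le (by positivity : 0 ≤ 200 * d)
  have hbs : (((s / 8 : ℕ) : ℕ) : ℝ) ≤ s / 8 := Nat.cast_div_le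
  have huc : 2 * (s / 8) + 4 ≤ ⌊100 * d⌋₊ := by
    have : (2 * (s / 8 : ℕ) + 4 : ℝ) ≤ ⌊100 * d⌋₊ := by linarith
    exact_mod_cast this
  have huc' : ⌊100 * d⌋₊ ≤ 4000 * s := by
    have : (⌊100 * d⌋₊ : ℝ) ≤ 4000 * s := by linarith
    exact_mod_cast this
  -- With `b` about `d / 320`, the cycle keeps at least `⌊100 d⌋ - 2 * b - 1` centres, well above
  -- `98 d`; the extra `1` in `K` makes `K + b < |U|` strict.
  obtain ⟨Z, hZ, h⟩ := SimpleGraph.exists_set_with_cycles (G := H) (Q := Q) (s := s)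
    (zc := ⌊200 * d⌋₊) (uc := ⌊100 * d⌋₊) (b := s / 8) (K := ⌊100 * d⌋₊ - s / 8 - 1) hQ200
    (by
      have h1 : (Q : ℝ) ^ 23 * 40 ≤ d := by
        calc (Q : ℝ) ^ 23 * 40 ≤ (q ^ 2) ^ 23 * q := by gcongr; linarith
          _ = q ^ 47 := by ring
          _ ≤ q ^ 100 := pow_le_pow_right₀ hq1 (by norm_num)
          _ ≤ Real.log (Fintype.card V) ^ 100 := by gcongr
          _ ≤ d := hlog
      have h2 : (Q : ℝ) ^ 23 ≤ s := by linarith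
      exact_mod_cast h2)
    (by
      have h1 : (Q : ℝ) ^ 40 * 450 ≤ 450 * Fintype.card V / d := by
        calc (Q : ℝ) ^ 40 * 450 ≤ (q ^ 2) ^ 40 * q ^ 2 := by
              gcongr
              nlinarith
          _ = q ^ 82 := by ring
          _ ≤ _ := by rw [← hexpq]; exact hC₁ q (hc1.trans hcq)
      rw [le_div_iff₀ hd0] at h1
      have h2 : (Q : ℝ) ^ 40 * s ≤ Fintype.card V := by
        have h3 : (Q : ℝ) ^ 40 * s ≤ Q ^ 40 * d := by gcongr; linarith
        linarith
      exact_mod_cast h2)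
    (fun v => by
      have h1 : (H.minDegree : ℝ) ≤ H.degree v := by exact_mod_cast H.minDegree_le_degree v
      have h2 : (2 * s : ℝ) ≤ H.degree v := by linarith
      exact_mod_cast h2)
    (fun v => by
      have h1 : (H.degree v : ℝ) ≤ H.maxDegree := by exact_mod_cast H.degree_le_maxDegree v
      have h2 : L * d ≤ Q * s := by
        calc L * d = (40 * L) * (d / 40) := by ring
          _ ≤ Q * s := by gcongr; linarith
      have h3 : (H.degree v : ℝ) ≤ Q * s := by linarith
      exact_mod_cast h3)
    (fun X hX hX' => hH.card_le_mul hε₁ hd0 hqQ (by linarith)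
      (hds.trans (by exact_mod_cast hX)) hX')
    (by
      have h1 := exp_le_one_add_pow (by omega : 0 < Q) hqQ
      rw [hexpq] at h1
      calc (Fintype.card V : ℝ) < 2 * (d / 40 * (450 * Fintype.card V / d)) := by
            have : 2 * (d / 40 * (450 * Fintype.card V / d)) = 22.5 * Fintype.card V := by
              field_simp; norm_num
            rw [this]; linarith
        _ ≤ _ := by gcongr)
    (by
      have : (⌊200 * d⌋₊ : ℝ) ≤ 8000 * s := by linarith
      exact_mod_cast this)
    (by omega) (by omega) (by omega) (by omega)
  refine ⟨Z, hZ, fun U hUZ hU => ?_⟩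
  obtain ⟨v, C, hC, hCU, hcard⟩ := h U hUZ hU
  refine ⟨v, C, hC, hCU, ?_⟩
  have h1 : ⌊100 * d⌋₊ ≤ (C.support.toFinset ∩ Z).card + 2 * (s / 8) + 1 := by omega
  have h2 : (⌊100 * d⌋₊ : ℝ) ≤ (C.support.toFinset ∩ Z).card + 2 * (s / 8 : ℕ) + 1 := by
    exact_mod_cast h1
  linarith
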